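/- Let $m,n,k,d$ be positive integers and $q$ a prime power such that $1\le k\le m$, $d\le n$, $d\le m$ and $q\ge m+d-2$. Then there exists an $\mathbb{F}_q$-$[n\times m,k,d]$ rank-metric code that is MTR (minimal tensor rank), that is, an $\mathbb{F}_q$-linear subspace $\mathcal{C}\le\mathbb{F}_q^{n\times m}$ with $\dim_{\mathbb{F}_q}(\mathcal{C})=k$, minimum rank distance $d(\mathcal{C})=\min\{\mathrm{rk}(X): X\in\mathcal{C},\,X\ne 0\}=d$, and tensor rank attaining Kruskal's lower bound $\mathrm{trk}(\mathcal{C})\ge\dim_{\mathbb{F}_q}(\mathcal{C})+d(\mathcal{C})-1$ with equality: \[\mathrm{trk}(\mathcal{C})=k+d-1.\] Here a tensor $X=(X_1\mid\cdots\mid X_k)\in\mathbb{F}_q^{k\times n\times m}$ is called a generator tensor of a $k$-dimensional subspace $\mathcal{C}$ if $\mathcal{C}$ is the span of its slices $X_1,\dots,X_k$; the tensor rank $\mathrm{trk}(X)$ is the least $R$ such that $X=\sum_{r=1}^R u_r\otimes v_r\otimes w_r$ for some $u_r\in\mathbb{F}_q^k$, $v_r\in\mathbb{F}_q^n$, $w_r\in\mathbb{F}_q^m$;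 and $\mathrm{trk}(\mathcal{C})$ is the tensor rank of any generator tensor of $\mathcal{C}$ (it does not depend on the choice). -/

import Mathlib

namespace RankMetric

/-- A 3-tensor in `K^{k × n × m}`, as the array `(X_1 | ⋯ | X_k)` of its `n × m` slices. -/
abbrev Tensor3 (K : Type*) (k n m : ℕ) : Type _ := Fin k → Matrix (Fin n) (Fin m) K

section Field

variable {K : Type*} [Field K] {k n m : ℕ}

/-- The coordinate array of the simple tensor `u ⊗ v ⊗ w`. -/
def simpleTensor (u : Fin k → K) (v : Fin n → K) (w : Fin m → K) : Tensor3 K k n m :=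
  fun l => Matrix.of fun i j => u l * v i * w j

/-- `X` is a sum of `R` simple tensors. -/
def IsSumOfSimple (X : Tensor3 K k n m) (R : ℕ) : Prop :=
  ∃ (u : Fin R → Fin k → K) (v : Fin R → Fin n → K) (w : Fin R → Fin m → K),
    X = ∑ r, simpleTensor (u r) (v r) (w r)

/-- The tensor rank: the least `R` such that `X` is a sum of `R` simple tensors. -/
noncomputable def tensorRank (X : Tensor3 K k n m) : ℕ :=
  sInf {R : ℕ | IsSumOfSimple X R}

/-- The first slice space of a tensor. -/
def firstSliceSpace (X : Tensor3 K k n m) : Submodule K (Matrix (Fin n) (Fin m) K) :=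
  Submodule.span K (Set.range X)

/-- A generator tensor of the space `V` of matrices: a tensor with exactly `dim V` slices whose
first slice space is `V`. -/
def IsGeneratorTensor (V : Submodule K (Matrix (Fin n) (Fin m) K))
    (X : Tensor3 K (Module.finrank K V) n m) : Prop :=
  firstSliceSpace X = V

/-- The generator tensor of `V` whose slices are a basis of `V`. -/
noncomputable def generatorTensor (V : Submodule K (Matrix (Fin n) (Fin m) K)) :
    Tensor3 K (Module.finrank K V) n m :=
  fun l => (Module.finBasis K V l : Matrix (Fin n) (Fin m) K)

/-- The tensor rank of a space of matrices: the tensor rank of a generator tensor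
(of any generator tensor, by `tensorRank_eq_trk`). -/
noncomputable def trk (V : Submodule K (Matrix (Fin n) (Fin m) K)) : ℕ :=
  tensorRank (generatorTensor V)

/-- The minimum rank distance of a code: the least rank of a nonzero element, and by convention
`n + 1` for the zero code. -/
noncomputable def minDist (C : Submodule K (Matrix (Fin n) (Fin m) K)) : ℕ :=
  open Classical in
  if C = ⊥ then n + 1
  else sInf {r : ℕ | ∃ X ∈ C, X ≠ 0 ∧ X.rank = r}

/-- `C` is a code with parameters `[n × m, k, d]`. -/
def HasParameters (C : Submodule K (Matrix (Fin n) (Fin m) K)) (k d : ℕ) : Prop :=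
  Module.finrank K C = k ∧ minDist C = d

/-- Minimal tensor rank: `C` attains the bound `trk C ≥ dim C + d(C) - 1`. (The subtraction is
never truncated, since `d(C) ≥ 1` for every `C`.) -/
def IsMTR (C : Submodule K (Matrix (Fin n) (Fin m) K)) : Prop :=
  trk C = Module.finrank K C + minDist C - 1

theorem generatorTensor_isGeneratorTensor (V : Submodule K (Matrix (Fin n) (Fin m) K)) :
    IsGeneratorTensor V (generatorTensor V) := by
  have h : Set.range (generatorTensor V) = V.subtype '' Set.range (Module.finBasis K V) := by
    rw [← Set.range_comp]; rfl
  rw [IsGeneratorTensor, firstSliceSpace, h, Submodule.span_image, (Module.finBasis K V).span_eq,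
    Submodule.map_subtype_top]

/-- Every tensor is a sum of simple tensors, so the tensor rank is an attained minimum. -/
theorem exists_isSumOfSimple (X : Tensor3 K k n m) : ∃ R, IsSumOfSimple X R := by
  let e := (Fintype.equivFin (Fin k × Fin n × Fin m)).symm
  refine ⟨_, fun r => Pi.single (e r).1 (X (e r).1 (e r).2.1 (e r).2.2),
    fun r => Pi.single (e r).2.1 1, fun r => Pi.single (e r).2.2 1, ?_⟩
  rw [Equiv.sum_comp e (fun p : Fin k × Fin n × Fin m =>
    simpleTensor (Pi.single p.1 (X p.1 p.2.1 p.2.2)) (Pi.single p.2.1 (1 : K))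
      (Pi.single p.2.2 (1 : K)))]
  ext l i j
  simp only [Finset.sum_apply, Matrix.sum_apply, simpleTensor, Matrix.of_apply, Pi.single_apply,
    Fintype.sum_prod_type]
  simp

theorem tensorRank_spec (X : Tensor3 K k n m) : IsSumOfSimple X (tensorRank X) :=
  Nat.sInf_mem (exists_isSumOfSimple X)

theorem tensorRank_mono {k' : ℕ} {X : Tensor3 K k n m} {Y : Tensor3 K k' n m}
    (h : firstSliceSpace X ≤ firstSliceSpace Y) : tensorRank X ≤ tensorRank Y := by
  obtain ⟨u, v, w, hY⟩ := tensorRank_spec Y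
  have hX : ∀ l, ∃ c : Fin k' → K, ∑ p, c p • Y p = X l := fun l =>
    (Submodule.mem_span_range_iff_exists_fun K).1 (h (Submodule.subset_span ⟨l, rfl⟩))
  choose c hc using hX
  refine Nat.sInf_le ⟨fun r l => ∑ p, c l p * u r p, v, w, ?_⟩
  have hY' : ∀ p i j, Y p i j = ∑ r, u r p * v r i * w r j := by
    intro p i j
    conv_lhs => rw [hY]
    simp only [Finset.sum_apply, Matrix.sum_apply, simpleTensor, Matrix.of_apply]
  ext l i j
  rw [← hc l]
  simp only [Finset.sum_apply, Matrix.sum_apply, simpleTensor, Matrix.of_apply, Matrix.smul_apply,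
    smul_eq_mul, hY', Finset.mul_sum, Finset.sum_mul]
  rw [Finset.sum_comm]
  exact Finset.sum_congr rfl fun r _ => Finset.sum_congr rfl fun p _ => by ring

/-- The tensor rank of a space does not depend on the generator tensor. -/
theorem tensorRank_eq_trk (V : Submodule K (Matrix (Fin n) (Fin m) K))
    (X : Tensor3 K (Module.finrank K V) n m) (hX : IsGeneratorTensor V X) :
    tensorRank X = trk V := by
  have h : firstSliceSpace X = firstSliceSpace (generatorTensor V) :=
    hX.trans (generatorTensor_isGeneratorTensor V).symm
  exact le_antisymm (tensorRank_mono h.le) (tensorRank_mono h.ge)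

end Field

end RankMetric

/-! Let θ generate the degree `m` extension `L` of `F`. The code consists of multiplication by
`g(θ)`, `deg g < k`, on the span of `1, θ, …, θ ^ (d - 1)`. As `L` is a field, multiplication by
`g(θ) ≠ 0` is injective, so ranks are at least `d` (`le_rank_sum_smul_powerTensor`). A product of
polynomials of degrees `< k` and `< d` is determined by its values at `k + d - 2` points of `F` and
its coefficient at infinity; each of these is a product of linear forms in the two factors, hence
one simple tensor (`isSumOfSimple_powerTensor`). Conversely, some nonzero combination of slices
kills `k - 1` of `R` simple tensors (`exists_rank_sum_smul_le`); this yields both Kruskal's bound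
and minimum distance at most `d`. -/

namespace RankMetric

section Kruskal

variable {K : Type*} [Field K] {k n m : ℕ}

/-- The tensor rank of a tensor is that of its slice space. -/
theorem trk_span_range (X : Tensor3 K k n m) :
    trk (Submodule.span K (Set.range X)) = tensorRank X := by
  have h : firstSliceSpace (generatorTensor (Submodule.span K (Set.range X))) =
      firstSliceSpace X := generatorTensor_isGeneratorTensor _
  exact le_antisymm (tensorRank_mono h.le) (tensorRank_mono h.ge)

/-- The rank of a combination of slices is thus at most the number of nonzero weights on the
diagonal. -/
theorem sum_smul_eq_mul_diagonal_mul {R : ℕ} (u : Fin R → Fin k → K) (v : Fin R → Fin n → K)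
    (w : Fin R → Fin m → K) (c : Fin k → K) :
    ∑ l, c l • (∑ r, simpleTensor (u r) (v r) (w r)) l =
      (Matrix.of v).transpose * Matrix.diagonal (fun r => ∑ l, c l * u r l) * Matrix.of w := by
  ext i j
  rw [Matrix.mul_apply]
  simp only [Finset.sum_apply, Matrix.sum_apply, Matrix.smul_apply, simpleTensor, Matrix.of_apply,
    smul_eq_mul, Matrix.mul_diagonal, Matrix.transpose_apply, Finset.mul_sum,
    Finset.sum_mul]
  rw [Finset.sum_comm]
  exact Finset.sum_congr rfl fun r _ => Finset.sum_congr rfl fun l _ => by ring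

/-- Fewer than `k` linear functionals on `K ^ k` have a common nontrivial zero. -/
theorem exists_ne_zero_forall_lt_sum_eq_zero (hk : 0 < k) {R : ℕ} (u : Fin R → Fin k → K) :
    ∃ c : Fin k → K, c ≠ 0 ∧ ∀ r : Fin R, (r : ℕ) < k - 1 → ∑ l, c l * u r l = 0 := by
  -- Zero rows pad the system when `R < k - 1`.
  let U : Matrix (Fin (k - 1)) (Fin k) K :=
    Matrix.of fun j l => if h : (j : ℕ) < R then u ⟨j, h⟩ l else 0
  have hker : LinearMap.ker U.mulVecLin ≠ ⊥ :=
    LinearMap.ker_ne_bot_of_finrank_lt (by simp only [Module.finrank_fin_fun]; omega)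
  obtain ⟨c, hc, hc0⟩ := Submodule.exists_mem_ne_zero_of_ne_bot hker
  refine ⟨c, hc0, fun r hr => ?_⟩
  have h := congrFun (LinearMap.mem_ker.1 hc) ⟨r, hr⟩
  simpa [U, Matrix.mulVec, dotProduct, mul_comm] using h

/-- Some nontrivial combination of the `k` slices of a sum of `R` simple tensors involves only
`R - (k - 1)` of them. -/
theorem exists_rank_sum_smul_le (hk : 0 < k) {X : Tensor3 K k n m} {R : ℕ}
    (hX : IsSumOfSimple X R) :
    ∃ c : Fin k → K, c ≠ 0 ∧ (∑ l, c l • X l).rank ≤ R - (k - 1) := by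
  classical
  obtain ⟨u, v, w, rfl⟩ := hX
  obtain ⟨c, hc0, hc⟩ := exists_ne_zero_forall_lt_sum_eq_zero hk u
  refine ⟨c, hc0, ?_⟩
  rw [sum_smul_eq_mul_diagonal_mul]
  refine (Matrix.rank_mul_le_left _ _).trans ((Matrix.rank_mul_le_right _ _).trans ?_)
  rw [Matrix.rank_diagonal]
  let f : {r : Fin R // ∑ l, c l * u r l ≠ 0} → Fin (R - (k - 1)) := fun r =>
    ⟨r.1 - (k - 1), by
      have := r.1.2
      have : ¬ (r.1 : ℕ) < k - 1 := fun h => r.2 (hc _ h)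
      omega⟩
  have hf : Function.Injective f := fun r s hrs => by
    have h : (r.1 : ℕ) - (k - 1) = s.1 - (k - 1) := congrArg Fin.val hrs
    have h₁ : ¬ (r.1 : ℕ) < k - 1 := fun h => r.2 (hc _ h)
    have h₂ : ¬ (s.1 : ℕ) < k - 1 := fun h => s.2 (hc _ h)
    exact Subtype.ext (Fin.ext (by omega))
  simpa using Fintype.card_le_of_injective f hf

/-- If all nontrivial combinations of the slices of `X` have rank at least `d`, and `X` is a sum of
at most `k + d - 1` simple tensors, then the slices span an MTR code. -/
theorem hasParameters_and_isMTR_span {d : ℕ} (hk : 0 < k) (hd : 0 < d) {X : Tensor3 K k n m}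
    (hrank : ∀ c : Fin k → K, c ≠ 0 → d ≤ (∑ l, c l • X l).rank)
    (hX : IsSumOfSimple X (k + d - 1)) :
    HasParameters (Submodule.span K (Set.range X)) k d ∧
      IsMTR (Submodule.span K (Set.range X)) := by
  have hne : ∀ c : Fin k → K, c ≠ 0 → ∑ l, c l • X l ≠ 0 := fun c hc h => by
    have := hrank c hc
    rw [h, Matrix.rank_zero] at this
    omega
  have hli : LinearIndependent K X := by
    rw [Fintype.linearIndependent_iff]
    intro c hc
    by_contra! h
    exact hne c (fun h0 => by simp [h0] at h) hc
  have hmem : ∀ c : Fin k → K, ∑ l, c l • X l ∈ Submodule.span K (Set.range X) := fun c =>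
    (Submodule.mem_span_range_iff_exists_fun K).2 ⟨c, rfl⟩
  have hfin : Module.finrank K (Submodule.span K (Set.range X)) = k := by
    simpa using finrank_span_eq_card hli
  have hbot : Submodule.span K (Set.range X) ≠ ⊥ := fun h => by
    rw [h, finrank_bot] at hfin
    omega
  have hdist : minDist (Submodule.span K (Set.range X)) = d := by
    rw [minDist, if_neg hbot]
    have hlb : ∀ Y ∈ Submodule.span K (Set.range X), Y ≠ 0 → d ≤ Y.rank := by
      intro Y hY hY0
      obtain ⟨c, rfl⟩ := (Submodule.mem_span_range_iff_exists_fun K).1 hY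
      exact hrank c fun h => hY0 (by simp [h])
    -- With `R = k + d - 1` the bound `R - (k - 1)` is exactly `d`.
    obtain ⟨c, hc, hcr⟩ := exists_rank_sum_smul_le hk hX
    have hle := hrank c hc
    refine le_antisymm (Nat.sInf_le ⟨_, hmem c, hne c hc, by omega⟩) ?_
    refine le_csInf ⟨_, _, hmem c, hne c hc, rfl⟩ ?_
    rintro _ ⟨Y, hY, hY0, rfl⟩
    exact hlb Y hY hY0
  refine ⟨⟨hfin, hdist⟩, ?_⟩
  rw [IsMTR, hfin, hdist, trk_span_range]
  refine le_antisymm (Nat.sInf_le hX) ?_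
  -- An optimal decomposition gives `d ≤ R - (k - 1)`; since `d > 0`, the subtraction is not
  -- truncated.
  obtain ⟨c, hc, hcr⟩ := exists_rank_sum_smul_le hk (tensorRank_spec X)
  have hle := hrank c hc
  omega

end Kruskal

section Construction

open Polynomial

/-- Lagrange interpolation at the points of `s` and at infinity. -/
theorem eq_interpolate_add_coeff_mul_nodal {F : Type*} [Field F] [DecidableEq F] (s : Finset F)
    {f : F[X]} (hf : f.natDegree ≤ s.card) :
    f = ∑ a ∈ s, f.eval a • Lagrange.basis s id a +
      f.coeff s.card • Lagrange.nodal s id := by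
  simp only [smul_eq_C_mul]
  have hinj : Set.InjOn (id : F → F) s := Function.injective_id.injOn
  -- The nodal polynomial is monic and vanishes on `s`, so `g` has degree below `s.card` and the
  -- values of `f` on `s`.
  set g := f - C (f.coeff s.card) * Lagrange.nodal s id with hg
  have hnd : (Lagrange.nodal s (id : F → F)).natDegree = s.card := Lagrange.natDegree_nodal
  have hcoeff : (Lagrange.nodal s (id : F → F)).coeff s.card = 1 := by
    have := (Lagrange.nodal_monic (s := s) (v := (id : F → F))).coeff_natDegree
    rwa [hnd] at this
  have hdeg : g.degree < s.card := by
    rw [degree_lt_iff_coeff_zero]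
    intro N hN
    rw [hg, coeff_sub, coeff_C_mul]
    rcases hN.eq_or_lt with rfl | hN
    · rw [hcoeff, mul_one, sub_self]
    · rw [coeff_eq_zero_of_natDegree_lt (hf.trans_lt hN),
        coeff_eq_zero_of_natDegree_lt (hnd.trans_lt hN), mul_zero, sub_zero]
  have h := Lagrange.eq_interpolate_of_eval_eq (fun a => f.eval a) hinj hdeg (fun a ha => by
    have := Lagrange.eval_nodal_at_node (R := F) (v := id) ha
    simp only [id] at this
    simp [hg, this])
  rw [Lagrange.interpolate_apply] at h
  rw [← h, hg, sub_add_cancel]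

variable {F L : Type*} [Field F] [Field L] [Algebra F L] {m : ℕ}

/-- The tensor of the multiplication `F[X]_{<k} × F[X]_{<d} → L` at `θ`, in the basis `b` of `L`
and with `n - d` rows of zeros added. -/
noncomputable def powerTensor (b : Module.Basis (Fin m) F L) (θ : L) (k n d : ℕ) :
    Tensor3 F k n m :=
  fun l => Matrix.of fun i j => if (i : ℕ) < d then b.repr (θ ^ ((i : ℕ) + l)) j else 0

/-- The first `d` rows are the coordinates of `g * θ ^ i`, where `k ≤ m` ensures `g ≠ 0` and `d ≤ m`
that the powers are independent. -/
theorem le_rank_sum_smul_powerTensor (b : Module.Basis (Fin m) F L) {θ : L}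
    (hθ : LinearIndependent F fun i : Fin m => θ ^ (i : ℕ)) {k n d : ℕ} (hkm : k ≤ m)
    (hdm : d ≤ m) (hdn : d ≤ n) {c : Fin k → F} (hc : c ≠ 0) :
    d ≤ (∑ l, c l • powerTensor b θ k n d l).rank := by
  set A := ∑ l, c l • powerTensor b θ k n d l with hA
  set g : L := ∑ l, c l • θ ^ (l : ℕ) with hg
  have hg0 : g ≠ 0 := fun h => hc <| funext <|
    Fintype.linearIndependent_iff.1 (hθ.comp (Fin.castLE hkm) (Fin.castLE_injective hkm)) c h
  have hrow : (A.submatrix (Fin.castLE hdn) id).row =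
      fun i : Fin d => b.equivFun (g * θ ^ (i : ℕ)) := by
    ext i j
    simp [hA, hg, Matrix.sum_apply, powerTensor, Finset.sum_mul, pow_add, mul_comm (θ ^ (i : ℕ))]
  have hli : LinearIndependent F (A.submatrix (Fin.castLE hdn) id).row := by
    rw [hrow]
    have h₁ : LinearIndependent F fun i : Fin d => θ ^ (i : ℕ) :=
      hθ.comp (Fin.castLE hdm) (Fin.castLE_injective hdm)
    have h₂ : LinearIndependent F fun i : Fin d => g * θ ^ (i : ℕ) :=
      h₁.map' (LinearMap.mulLeft F g)
        (LinearMap.ker_eq_bot.2 fun x y hxy => mul_left_cancel₀ hg0 hxy)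
    exact h₂.map' b.equivFun.toLinearMap b.equivFun.ker
  have h := hli.rank_matrix
  rw [Fintype.card_fin] at h
  exact h.symm.le.trans (Matrix.rank_submatrix_le _ _ _)

theorem isSumOfSimple_powerTensor (b : Module.Basis (Fin m) F L) (θ : L) {k n d : ℕ}
    (hk : 0 < k) (hd : 0 < d) (s : Finset F) (hs : s.card = k + d - 2) :
    IsSumOfSimple (powerTensor b θ k n d) (k + d - 1) := by
  classical
  have hcard : k + d - 1 = s.card + 1 := by omega
  rw [hcard]
  let e : Fin s.card ≃ s := s.equivFin.symm
  -- One term per point of `s`; the last is the point at infinity.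
  refine ⟨Fin.snoc (fun r l => (e r : F) ^ (l : ℕ)) fun l => if (l : ℕ) = k - 1 then 1 else 0,
    Fin.snoc (fun r i => if (i : ℕ) < d then (e r : F) ^ (i : ℕ) else 0)
      fun i => if (i : ℕ) = d - 1 then 1 else 0,
    Fin.snoc (fun r => b.equivFun (aeval θ (Lagrange.basis s id (e r : F))))
      (b.equivFun (aeval θ (Lagrange.nodal s id))), ?_⟩
  ext l i j
  simp only [Fin.sum_univ_castSucc, Fin.snoc_castSucc, Fin.snoc_last, Finset.sum_apply,
    Matrix.sum_apply, simpleTensor, Matrix.of_apply,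
    powerTensor]
  by_cases hi : (i : ℕ) < d
  · have hl := l.2
    have hinterp := eq_interpolate_add_coeff_mul_nodal s (f := (X : F[X]) ^ ((i : ℕ) + l))
      (by rw [natDegree_X_pow]; omega)
    have h := congrArg (fun p => b.repr (aeval θ p) j) hinterp
    -- Since `i ≤ d - 1` and `l ≤ k - 1`, the sum `i + l` reaches `k + d - 2` only when both are
    -- maximal.
    have hc : ((X : F[X]) ^ ((i : ℕ) + l)).coeff s.card =
        (if (l : ℕ) = k - 1 then 1 else 0) * (if (i : ℕ) = d - 1 then 1 else 0) := by
      rw [coeff_X_pow, ite_mul, one_mul, zero_mul, ← ite_and]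
      exact if_congr (by omega) rfl rfl
    rw [hc] at h
    simp only [map_pow, aeval_X, map_add, map_sum, map_smul, Finsupp.add_apply,
      Finsupp.finsetSum_apply, Finsupp.smul_apply, smul_eq_mul, eval_pow, eval_X] at h
    simp only [if_pos hi, Module.Basis.equivFun_apply]
    rw [h, ← Finset.sum_coe_sort, ← e.sum_comp]
    congr 1
    exact Finset.sum_congr rfl fun r _ => by rw [pow_add]; ring
  · have hi' : (i : ℕ) ≠ d - 1 := by omega
    simp [hi, hi']

end Construction

/-- A finite field has a simple extension of every positive degree. -/
theorem exists_powerBasis_dim_eq (F : Type*) [Field F] [Finite F] {m : ℕ} (hm : 0 < m) :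
    ∃ (L : Type) (_ : Field L) (_ : Algebra F L) (pb : PowerBasis F L), pb.dim = m := by
  obtain ⟨p, hp⟩ := CharP.exists F
  have : Fact p.Prime := ⟨CharP.char_is_prime F p⟩
  have : NeZero m := ⟨hm.ne'⟩
  refine ⟨FiniteField.Extension F p m, inferInstance, inferInstance,
    Field.powerBasisOfFiniteOfSeparable F _, ?_⟩
  rw [← PowerBasis.finrank, FiniteField.finrank_extension]

end RankMetric

theorem mainTheorem3 (q : ℕ) (F : Type*) [Field F] [Finite F] (hF : Nat.card F = q)
    (m n k d : ℕ) (hm : 0 < m) (hn : 0 < n) (hd : 0 < d)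
    (hk : 1 ≤ k) (hkm : k ≤ m) (hdn : d ≤ n) (hdm : d ≤ m) (hq : m + d - 2 ≤ q) :
    ∃ C : Submodule F (Matrix (Fin n) (Fin m) F),
      RankMetric.HasParameters C k d ∧ RankMetric.IsMTR C := by
  have := Fintype.ofFinite F
  obtain ⟨L, _, _, pb, rfl⟩ := RankMetric.exists_powerBasis_dim_eq F hm
  obtain ⟨s, -, hs⟩ := Finset.exists_subset_card_eq (s := (Finset.univ : Finset F))
    (n := k + d - 2) (by rw [Finset.card_univ, ← Nat.card_eq_fintype_card]; omega)
  have hθ : LinearIndependent F fun i : Fin pb.dim => pb.gen ^ (i : ℕ) := by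
    simpa only [PowerBasis.coe_basis] using pb.basis.linearIndependent
  exact ⟨_, RankMetric.hasParameters_and_isMTR_span hk hd
    (fun _ hc => RankMetric.le_rank_sum_smul_powerTensor pb.basis hθ hkm hdm hdn hc)
    (RankMetric.isSumOfSimple_powerTensor pb.basis pb.gen hk hd s hs)⟩
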